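/- Let $A\colon\mathbb{R}\to M_n(\mathbb{R})$ be continuous. The system $\dot x=A(t)x$ has an *exponential dichotomy* on $\mathbb{R}$ if, for a fundamental matrix $X(t)$, there are a constant projection $P=P^2$ and constants $K,\alpha>0$ such that $\|X(t)PX^{-1}(s)\|\le Ke^{-\alpha(t-s)}$ for all $t\ge s$ and $\|X(t)(I-P)X^{-1}(s)\|\le Ke^{-\alpha(s-t)}$ for all $t\le s$. The *exponential dichotomy spectrum* $\Sigma(A)$ is the set of $\lambda\in\mathbb{R}$ for which $\dot x=[A(t)-\lambda I]x$ has no exponential dichotomy on $\mathbb{R}$. Two systems $\dot x=A(t)x$ and $\dot y=B(t)y$ with continuous coefficients $A,B\colon\mathbb{R}\to M_n(\mathbb{R})$ are *generally kinematically similar* if there is a differentiable $Q\colon\mathbb{R}\to M_n(\mathbb{R})$ with invertible values such that $Q$, $Q^{-1}$ and $\dot Q$ are continuous, $\sup_{t\in\mathbb{R}}\left[\|Q(t)\|+\|Q^{-1}(t)\|\right]<+\infty$, and $\dot Q(t)=A(t)Q(t)-Q(t)B(t)$ for all $t\in\mathbb{R}$. **Theorem.** Let $\ell\ge 1$ and suppose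 that $$\Sigma(A)=[a_1,b_1]\cup[a_2,b_2]\cup\cdots\cup[a_\ell,b_\ell],\qquad a_1\le b_1<a_2\le b_2<\cdots<a_\ell\le b_\ell .$$ Then there exist $n_1,\dots,n_\ell$ with $n_1+\cdots+n_\ell=n$ and continuous matrix functions $B_i\colon\mathbb{R}\to M_{n_i}(\mathbb{R})$ with $\Sigma(B_i)=[a_i,b_i]$ for $i=1,\dots,\ell$, such that $\dot x=A(t)x$ is generally kinematically similar to $$\dot y=\operatorname{diag}\bigl(B_1(t),B_2(t),\dots,B_\ell(t)\bigr)\,y .$$ -/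

import Mathlib

open scoped Matrix.Norms.L2Operator

/-- `X` is a fundamental matrix, on the whole line, of the linear system `x' = A(t) x`: its columns
are solutions and, for every `t`, they form a basis of the state space. Matrices carry the operator
norm induced by the Euclidean norm. -/
def IsFundamentalMatrix {ι : Type*} [Fintype ι] [DecidableEq ι]
    (A X : ℝ → Matrix ι ι ℝ) : Prop :=
  (∀ t : ℝ, HasDerivAt X (A t * X t) t) ∧ ∀ t : ℝ, IsUnit (X t)

/-- The linear system `x' = A(t) x` has an exponential dichotomy on `ℝ`. The property does not
depend on the fundamental matrix, since any two differ by a constant invertible right factor. -/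
def HasExpDichotomy {ι : Type*} [Fintype ι] [DecidableEq ι] (A : ℝ → Matrix ι ι ℝ) : Prop :=
  ∃ X : ℝ → Matrix ι ι ℝ, IsFundamentalMatrix A X ∧
    ∃ (P : Matrix ι ι ℝ) (K α : ℝ), P * P = P ∧ 0 < K ∧ 0 < α ∧
      (∀ t s : ℝ, s ≤ t → ‖X t * P * (X s)⁻¹‖ ≤ K * Real.exp (-α * (t - s))) ∧
      (∀ t s : ℝ, t ≤ s → ‖X t * (1 - P) * (X s)⁻¹‖ ≤ K * Real.exp (-α * (s - t)))

/-- The exponential dichotomy spectrum `Σ(A)`: the set of real `γ` for which the shifted system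
`x' = (A(t) - γ I) x` has no exponential dichotomy on `ℝ`. -/
def expDichotomySpectrum {ι : Type*} [Fintype ι] [DecidableEq ι]
    (A : ℝ → Matrix ι ι ℝ) : Set ℝ :=
  {γ : ℝ | ¬ HasExpDichotomy (fun t => A t - γ • (1 : Matrix ι ι ℝ))}

/-- The systems `x' = A(t) x` and `y' = B(t) y`, with continuous coefficients, are generally
kinematically similar on `ℝ` (over the real field). -/
def GenerallyKinematicallySimilar {ι : Type*} [Fintype ι] [DecidableEq ι]
    (A B : ℝ → Matrix ι ι ℝ) : Prop :=
  Continuous A ∧ Continuous B ∧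
    ∃ Q : ℝ → Matrix ι ι ℝ,
      (∀ t : ℝ, IsUnit (Q t)) ∧ Differentiable ℝ Q ∧
      Continuous Q ∧ Continuous (fun t => (Q t)⁻¹) ∧ Continuous (deriv Q) ∧
      (∃ C : ℝ, ∀ t : ℝ, ‖Q t‖ + ‖(Q t)⁻¹‖ ≤ C) ∧
      ∀ t : ℝ, deriv Q t = A t * Q t - Q t * B t

/-- The `n × n` matrix `diag(B_1, …, B_ℓ)` with square blocks `B_i` of sizes `m i`, placed along the
diagonal in their order (`finSigmaFinEquiv` numbers the pairs `(i, k)` lexicographically). -/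
def blockDiag {n ℓ : ℕ} (m : Fin ℓ → ℕ) (hm : ∑ i, m i = n)
    (B : ∀ i : Fin ℓ, Matrix (Fin (m i)) (Fin (m i)) ℝ) : Matrix (Fin n) (Fin n) ℝ :=
  Matrix.reindex (finSigmaFinEquiv.trans (finCongr hm)) (finSigmaFinEquiv.trans (finCongr hm))
    (Matrix.blockDiagonal' B)

/-!
A point `γ` outside the spectrum provides an exponential dichotomy of the system shifted by `γ`,
with fundamental matrix `X` and projection `P`. The families `X P X⁻¹` and `X (1 - P) X⁻¹` of projections
are bounded. Applying Gram–Schmidt to the solutions which span the ranges gives orthonormal, hence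
bounded, continuously differentiable frames `E` and `G` of the stable and unstable subspaces
(`exists_contDiff_factor_gram`, `IsFundamentalMatrix.exists_invariant_frame`). The matrix `[E G]` is
the change of variables: its inverse is bounded because the projections are, and it carries the
system to a direct sum of a uniformly stable and a uniformly unstable one
(`HasExpDichotomy.exists_split`). No bound on the coefficients is needed, and existence of solutions
is part of the dichotomy.

A uniformly stable system remains so under every shift by a nonnegative number, so the first summand
has its spectrum below `γ`, and likewise the second one above `γ`. Since the spectrum is invariant
under kinematic similarity (`KinematicallySimilar.spectrum_eq`) and the spectrum of a direct sum is
the union of the spectra (`expDichotomySpectrum_fromBlocks`), the summands have exactly the parts of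
the spectrum on the two sides of `γ` (`exists_spectral_split`). The formula for direct sums rests on
the uniqueness of the dichotomy projection on the whole line, which forces it to be block diagonal.
Placing `γ` in the first gap and iterating on the second summand isolates the intervals one by one
(`exists_spectral_blocks`).

The induction changes the index type of the system, so kinematic similarity is formulated for
systems with different index types, by rectangular matrices.
-/

/-! ### Calculus of matrix-valued functions -/

section Calculus

variable {l m n : Type*} [Fintype l] [Fintype m] [Fintype n]
  [DecidableEq m] [DecidableEq n]

theorem HasDerivAt.rectMatrix_mul {F : ℝ → Matrix l m ℝ} {G : ℝ → Matrix m n ℝ}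
    {F' : Matrix l m ℝ} {G' : Matrix m n ℝ} {t : ℝ}
    (hF : HasDerivAt F F' t) (hG : HasDerivAt G G' t) :
    HasDerivAt (fun t => F t * G t) (F t * G' + F' * G t) t := by
  have h : IsBoundedBilinearMap ℝ fun p : Matrix l m ℝ × Matrix m n ℝ => p.1 * p.2 :=
    { add_left := fun _ _ _ => Matrix.add_mul _ _ _
      smul_left := fun _ _ _ => Matrix.smul_mul _ _ _
      add_right := fun _ _ _ => Matrix.mul_add _ _ _
      smul_right := fun _ _ _ => Matrix.mul_smul _ _ _
      bound := ⟨1, one_pos, fun _ _ => by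
        rw [one_mul]; exact Matrix.l2_opNorm_mul _ _⟩ }
  have h2 := (h.hasFDerivAt (F t, G t)).comp_hasDerivAt t (hF.prodMk hG)
  simpa using! h2

theorem HasDerivAt.matrix_inv {F : ℝ → Matrix n n ℝ} {F' : Matrix n n ℝ} {t : ℝ}
    (hF : HasDerivAt F F' t) (hu : IsUnit (F t)) :
    HasDerivAt (fun t => (F t)⁻¹) (-((F t)⁻¹ * F' * (F t)⁻¹)) t := by
  obtain ⟨u, hu⟩ := hu
  have h := hasFDerivAt_ringInverse (𝕜 := ℝ) u
  rw [hu] at h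
  have h2 := h.comp_hasDerivAt t hF
  have e : (↑u⁻¹ : Matrix n n ℝ) = (F t)⁻¹ := by
    rw [← hu, Matrix.coe_units_inv]
  simp only [Matrix.nonsing_inv_eq_ringInverse] at e ⊢
  rw [← e]
  simpa using! h2

theorem Continuous.matrix_inv_of_isUnit {F : ℝ → Matrix n n ℝ} (hF : Continuous F)
    (hu : ∀ t, IsUnit (F t)) : Continuous fun t => (F t)⁻¹ := by
  refine continuous_iff_continuousAt.2 fun t => ?_
  obtain ⟨u, hu⟩ := hu t
  have h := NormedRing.inverse_continuousAt u
  rw [hu] at h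
  simp only [Matrix.nonsing_inv_eq_ringInverse]
  exact h.comp hF.continuousAt

theorem Matrix.mul_inv_of_isUnit {M : Matrix n n ℝ} (h : IsUnit M) : M * M⁻¹ = 1 :=
  Matrix.mul_nonsing_inv _ ((Matrix.isUnit_iff_isUnit_det _).1 h)

theorem Matrix.inv_mul_of_isUnit {M : Matrix n n ℝ} (h : IsUnit M) : M⁻¹ * M = 1 :=
  Matrix.nonsing_inv_mul _ ((Matrix.isUnit_iff_isUnit_det _).1 h)

theorem Matrix.isUnit_of_mul_eq_one {M N : Matrix n n ℝ} (h : M * N = 1) : IsUnit M :=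
  (Matrix.isUnit_iff_isUnit_det _).2 (Matrix.isUnit_det_of_right_inverse h)

theorem Matrix.l2_opNorm_mul₃ {k : Type*} [Fintype k] [DecidableEq l]
    (L : Matrix k l ℝ) (M : Matrix l m ℝ) (N : Matrix m n ℝ) :
    ‖L * M * N‖ ≤ ‖L‖ * ‖M‖ * ‖N‖ :=
  (Matrix.l2_opNorm_mul _ _).trans
    (mul_le_mul_of_nonneg_right (Matrix.l2_opNorm_mul _ _) (norm_nonneg _))

end Calculus

/-! ### Fundamental matrices and dichotomies -/

section Dichotomy

variable {ι κ : Type*} [Fintype ι] [DecidableEq ι] [Fintype κ] [DecidableEq κ]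

/-- Solutions of a linear system are unique: `Y⁻¹ X` has derivative zero. -/
theorem IsFundamentalMatrix.eq_mul_const {A X Y : ℝ → Matrix ι ι ℝ}
    (hX : IsFundamentalMatrix A X) (hY : IsFundamentalMatrix A Y) :
    ∃ M : Matrix ι ι ℝ, IsUnit M ∧ ∀ t, X t = Y t * M := by
  have hd : ∀ t, HasDerivAt (fun t => (Y t)⁻¹ * X t) 0 t := fun t => by
    have h := ((hY.1 t).matrix_inv (hY.2 t)).rectMatrix_mul (hX.1 t)
    convert h using 1
    have := Matrix.mul_inv_of_isUnit (hY.2 t)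
    rw [Matrix.neg_mul, ← Matrix.mul_assoc (Y t)⁻¹ (A t) (Y t), Matrix.mul_assoc _ (Y t) (Y t)⁻¹,
      this, Matrix.mul_one, Matrix.mul_assoc]
    simp
  refine ⟨(Y 0)⁻¹ * X 0, ?_, fun t => ?_⟩
  · exact (Matrix.isUnit_nonsing_inv_iff.2 (hY.2 0)).mul (hX.2 0)
  · have hc : (Y t)⁻¹ * X t = (Y 0)⁻¹ * X 0 :=
      is_const_of_deriv_eq_zero (fun t => (hd t).differentiableAt) (fun t => (hd t).deriv) t 0
    rw [← hc, ← Matrix.mul_assoc, Matrix.mul_inv_of_isUnit (hY.2 t), Matrix.one_mul]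

/-- `P` is the projection, and `K`, `α` are constants, of an exponential dichotomy, measured by
the fundamental matrix `X`. -/
def IsDichotomy (X : ℝ → Matrix ι ι ℝ) (P : Matrix ι ι ℝ) (K α : ℝ) : Prop :=
  P * P = P ∧ 0 < K ∧ 0 < α ∧
    (∀ t s : ℝ, s ≤ t → ‖X t * P * (X s)⁻¹‖ ≤ K * Real.exp (-α * (t - s))) ∧
    (∀ t s : ℝ, t ≤ s → ‖X t * (1 - P) * (X s)⁻¹‖ ≤ K * Real.exp (-α * (s - t)))

theorem HasExpDichotomy.exists_isDichotomy {A X : ℝ → Matrix ι ι ℝ} (h : HasExpDichotomy A)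
    (hX : IsFundamentalMatrix A X) : ∃ P K α, IsDichotomy X P K α := by
  obtain ⟨Y, hY, P, K, α, hP, hK, hα, h1, h2⟩ := h
  obtain ⟨M, hM, hYX⟩ := hY.eq_mul_const hX
  have hMi := Matrix.inv_mul_of_isUnit hM
  have hMi' := Matrix.mul_inv_of_isUnit hM
  have key : ∀ (R : Matrix ι ι ℝ) (t s : ℝ),
      X t * (M * R * M⁻¹) * (X s)⁻¹ = Y t * R * (Y s)⁻¹ := fun R t s => by
    rw [hYX t, hYX s, Matrix.mul_inv_rev]
    simp only [Matrix.mul_assoc]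
  have h1M : (1 : Matrix ι ι ℝ) - M * P * M⁻¹ = M * (1 - P) * M⁻¹ := by
    rw [Matrix.mul_sub, Matrix.sub_mul, Matrix.mul_one, hMi']
  refine ⟨M * P * M⁻¹, K, α, ?_, hK, hα, fun t s hts => ?_, fun t s hts => ?_⟩
  · calc M * P * M⁻¹ * (M * P * M⁻¹) = M * P * (M⁻¹ * M) * P * M⁻¹ := by
          simp only [Matrix.mul_assoc]
      _ = M * P * M⁻¹ := by rw [hMi, Matrix.mul_one, Matrix.mul_assoc M, hP]
  · rw [key]; exact h1 t s hts
  · rw [h1M, key]; exact h2 t s hts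

/-- The stable directions of one dichotomy decay forward in time, while the unstable directions
of the other decay backward; an element of both would have to vanish. -/
theorem IsDichotomy.mul_eq {X : ℝ → Matrix ι ι ℝ} (hX : ∀ t, IsUnit (X t))
    {P P' : Matrix ι ι ℝ} {K α K' α' : ℝ}
    (h : IsDichotomy X P K α) (h' : IsDichotomy X P' K' α') : P' * P = P ∧ P' * P = P' := by
  obtain ⟨-, hK, hα, h1, h2⟩ := h
  obtain ⟨-, hK', hα', h1', h2'⟩ := h'
  -- a constant matrix which is squeezed by a decaying exponential is zero
  have squeeze : ∀ M : Matrix ι ι ℝ,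
      (∀ t : ℝ, 0 ≤ t → ‖X 0 * M * (X 0)⁻¹‖ ≤ K * K' * Real.exp (-(α + α') * t)) → M = 0 := by
    intro M hM
    have hlim : Filter.Tendsto (fun t : ℝ => K * K' * Real.exp (-(α + α') * t)) Filter.atTop
        (nhds 0) := by
      have : Filter.Tendsto (fun t : ℝ => -(α + α') * t) Filter.atTop Filter.atBot :=
        Filter.tendsto_id.const_mul_atTop_of_neg (by linarith)
      simpa using (Real.tendsto_exp_atBot.comp this).const_mul (K * K')
    have h0 : ‖X 0 * M * (X 0)⁻¹‖ ≤ 0 :=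
      ge_of_tendsto hlim ((Filter.eventually_ge_atTop 0).mono hM)
    have h00 : X 0 * M * (X 0)⁻¹ = 0 := norm_le_zero_iff.1 h0
    calc M = (X 0)⁻¹ * (X 0 * M * (X 0)⁻¹) * X 0 := by
          simp only [Matrix.mul_assoc, Matrix.inv_mul_of_isUnit (hX 0), Matrix.mul_one]
          rw [← Matrix.mul_assoc, Matrix.inv_mul_of_isUnit (hX 0), Matrix.one_mul]
      _ = 0 := by rw [h00]; simp
  have split : ∀ (R S : Matrix ι ι ℝ) (t : ℝ),
      X 0 * (R * S) * (X 0)⁻¹ = X 0 * R * (X t)⁻¹ * (X t * S * (X 0)⁻¹) := fun R S t => by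
    calc X 0 * (R * S) * (X 0)⁻¹ = X 0 * R * 1 * S * (X 0)⁻¹ := by
          simp only [Matrix.mul_assoc, Matrix.one_mul]
      _ = _ := by
          rw [← Matrix.inv_mul_of_isUnit (hX t)]; simp only [Matrix.mul_assoc]
  have e1 : (1 - P') * P = 0 := squeeze _ fun t ht => by
    rw [split _ _ t]
    refine (norm_mul_le _ _).trans ?_
    refine (mul_le_mul (h2' 0 t ht) (h1 t 0 ht) (norm_nonneg _) (by positivity)).trans_eq ?_
    rw [mul_mul_mul_comm, ← Real.exp_add, mul_comm K']
    ring_nf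
  have e2 : P' * (1 - P) = 0 := squeeze _ fun t ht => by
    rw [split _ _ (-t)]
    refine (norm_mul_le _ _).trans ?_
    refine (mul_le_mul (h1' 0 (-t) (by linarith)) (h2 (-t) 0 (by linarith)) (norm_nonneg _)
      (by positivity)).trans_eq ?_
    rw [mul_mul_mul_comm, ← Real.exp_add, mul_comm K']
    ring_nf
  rw [Matrix.sub_mul, Matrix.one_mul, sub_eq_zero] at e1
  rw [Matrix.mul_sub, Matrix.mul_one, sub_eq_zero] at e2
  exact ⟨e1.symm, e2.symm⟩

/-- The projection of an exponential dichotomy on the whole line is determined by the fundamental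
matrix. -/
theorem IsDichotomy.projection_unique {X : ℝ → Matrix ι ι ℝ} (hX : ∀ t, IsUnit (X t))
    {P P' : Matrix ι ι ℝ} {K α K' α' : ℝ}
    (h : IsDichotomy X P K α) (h' : IsDichotomy X P' K' α') : P = P' :=
  (h.mul_eq hX h').1.symm.trans (h.mul_eq hX h').2

theorem IsFundamentalMatrix.sub_smul_one {A X : ℝ → Matrix ι ι ℝ} (hX : IsFundamentalMatrix A X)
    (c : ℝ) :
    IsFundamentalMatrix (fun t => A t - c • (1 : Matrix ι ι ℝ))
      (fun t => Real.exp (-c * t) • X t) := by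
  refine ⟨fun t => ?_, fun t => (hX.2 t).smul (Units.mk0 _ (Real.exp_ne_zero (-c * t)))⟩
  have h1 : HasDerivAt (fun t => Real.exp (-c * t)) (Real.exp (-c * t) * (-c * 1)) t :=
    ((hasDerivAt_id t).const_mul (-c)).exp
  refine (h1.smul (hX.1 t)).congr_deriv ?_
  rw [Matrix.sub_mul, Matrix.mul_smul, Matrix.smul_mul, Matrix.one_mul, mul_one, mul_neg, neg_smul,
    mul_smul, smul_comm c, ← sub_eq_add_neg]

end Dichotomy

section Transfer

variable {ι κ μ : Type*} [Fintype ι] [DecidableEq ι] [Fintype κ] [DecidableEq κ]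
  [Fintype μ] [DecidableEq μ]

/-- A dichotomy is transported along any bounded two-sided factors; the constant `K` is enlarged
only to keep it positive. -/
theorem IsDichotomy.transfer {X : ℝ → Matrix ι ι ℝ} {Y : ℝ → Matrix κ κ ℝ} {P : Matrix ι ι ℝ}
    {P' : Matrix κ κ ℝ} {K α C : ℝ} (h : IsDichotomy X P K α) (hP' : P' * P' = P')
    {L : ℝ → Matrix κ ι ℝ} {R : ℝ → Matrix ι κ ℝ} (hL : ∀ t, ‖L t‖ ≤ C) (hR : ∀ t, ‖R t‖ ≤ C)
    (h1 : ∀ t s, Y t * P' * (Y s)⁻¹ = L t * (X t * P * (X s)⁻¹) * R s)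
    (h2 : ∀ t s, Y t * (1 - P') * (Y s)⁻¹ = L t * (X t * (1 - P) * (X s)⁻¹) * R s) :
    IsDichotomy Y P' (C * K * C + 1) α := by
  obtain ⟨-, hK, hα, e1, e2⟩ := h
  have hC : 0 ≤ C := (norm_nonneg _).trans (hL 0)
  have bound : ∀ (M : Matrix ι ι ℝ) (t s x : ℝ), ‖M‖ ≤ K * Real.exp x →
      ‖L t * M * R s‖ ≤ (C * K * C + 1) * Real.exp x := fun M t s x hM => by
    calc ‖L t * M * R s‖ ≤ ‖L t‖ * ‖M‖ * ‖R s‖ := Matrix.l2_opNorm_mul₃ _ _ _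
      _ ≤ C * (K * Real.exp x) * C := by
          gcongr
          · exact hL t
          · exact hR s
      _ ≤ (C * K * C + 1) * Real.exp x := by nlinarith [Real.exp_pos x]
  refine ⟨hP', by positivity, hα, fun t s hts => ?_, fun t s hts => ?_⟩
  · rw [h1]; exact bound _ _ _ _ (e1 t s hts)
  · rw [h2]; exact bound _ _ _ _ (e2 t s hts)

/-! ### Kinematic similarity between systems with different index types -/

/-- The bounded, boundedly invertible change of variables `x = Q(t) y` carries `x' = A(t) x` to
`y' = B(t) y`. The index types of the two systems may differ, so the inverse `R` of `Q` is part of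
the data, together with the differential equation which it satisfies. -/
structure IsKinematicSimilarity (A : ℝ → Matrix ι ι ℝ) (B : ℝ → Matrix κ κ ℝ)
    (Q : ℝ → Matrix ι κ ℝ) (R : ℝ → Matrix κ ι ℝ) : Prop where
  mul_inv : ∀ t, Q t * R t = 1
  inv_mul : ∀ t, R t * Q t = 1
  deriv : ∀ t, HasDerivAt Q (A t * Q t - Q t * B t) t
  deriv_inv : ∀ t, HasDerivAt R (B t * R t - R t * A t) t
  bounded : ∃ C : ℝ, ∀ t, ‖Q t‖ ≤ C ∧ ‖R t‖ ≤ C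

/-- The systems with coefficients `A` and `B` are kinematically similar. -/
def KinematicallySimilar (A : ℝ → Matrix ι ι ℝ) (B : ℝ → Matrix κ κ ℝ) : Prop :=
  ∃ Q R, IsKinematicSimilarity A B Q R

theorem KinematicallySimilar.symm {A : ℝ → Matrix ι ι ℝ} {B : ℝ → Matrix κ κ ℝ}
    (h : KinematicallySimilar A B) : KinematicallySimilar B A := by
  obtain ⟨Q, R, h1, h2, h3, h4, C, hC⟩ := h
  exact ⟨R, Q, h2, h1, h4, h3, C, fun t => (hC t).symm⟩

theorem KinematicallySimilar.trans {A : ℝ → Matrix ι ι ℝ} {B : ℝ → Matrix κ κ ℝ}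
    {D : ℝ → Matrix μ μ ℝ} (h : KinematicallySimilar A B) (h' : KinematicallySimilar B D) :
    KinematicallySimilar A D := by
  obtain ⟨Q, R, h1, h2, h3, h4, C, hC⟩ := h
  obtain ⟨Q', R', h1', h2', h3', h4', C', hC'⟩ := h'
  refine ⟨fun t => Q t * Q' t, fun t => R' t * R t, fun t => ?_, fun t => ?_, fun t => ?_,
    fun t => ?_, C * C', fun t => ⟨?_, ?_⟩⟩
  · rw [Matrix.mul_assoc, ← Matrix.mul_assoc (Q' t), h1', Matrix.one_mul, h1]
  · rw [Matrix.mul_assoc, ← Matrix.mul_assoc (R t), h2, Matrix.one_mul, h2']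
  · refine ((h3 t).rectMatrix_mul (h3' t)).congr_deriv ?_
    simp only [Matrix.mul_sub, Matrix.sub_mul, Matrix.mul_assoc]
    abel
  · refine ((h4' t).rectMatrix_mul (h4 t)).congr_deriv ?_
    simp only [Matrix.mul_sub, Matrix.sub_mul, Matrix.mul_assoc]
    abel
  · exact (Matrix.l2_opNorm_mul _ _).trans (mul_le_mul (hC t).1 (hC' t).1 (norm_nonneg _)
      ((norm_nonneg _).trans (hC t).1))
  · rw [mul_comm C]
    exact (Matrix.l2_opNorm_mul _ _).trans (mul_le_mul (hC' t).2 (hC t).2 (norm_nonneg _)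
      ((norm_nonneg _).trans (hC' t).2))

theorem KinematicallySimilar.sub_smul_one {A : ℝ → Matrix ι ι ℝ} {B : ℝ → Matrix κ κ ℝ}
    (h : KinematicallySimilar A B) (c : ℝ) :
    KinematicallySimilar (fun t => A t - c • (1 : Matrix ι ι ℝ))
      (fun t => B t - c • (1 : Matrix κ κ ℝ)) := by
  obtain ⟨Q, R, h1, h2, h3, h4, hC⟩ := h
  refine ⟨Q, R, h1, h2, fun t => (h3 t).congr_deriv ?_, fun t => (h4 t).congr_deriv ?_, hC⟩ <;>
  · simp only [Matrix.mul_sub, Matrix.sub_mul, Matrix.mul_smul, Matrix.smul_mul, Matrix.one_mul,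
      Matrix.mul_one]
    abel

theorem KinematicallySimilar.hasExpDichotomy {A : ℝ → Matrix ι ι ℝ} {B : ℝ → Matrix κ κ ℝ}
    (h : KinematicallySimilar A B) (hA : HasExpDichotomy A) : HasExpDichotomy B := by
  obtain ⟨Q, R, h1, h2, -, h4, C, hC⟩ := h
  obtain ⟨X, hX, P, K, α, hP⟩ := hA
  have hXi := fun t => Matrix.mul_inv_of_isUnit (hX.2 t)
  -- the factor `Q 0` on the right only serves to make the fundamental matrix square
  have hY : ∀ t, R t * X t * Q 0 * (R 0 * (X t)⁻¹ * Q t) = 1 := fun t => by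
    calc R t * X t * Q 0 * (R 0 * (X t)⁻¹ * Q t)
        = R t * (X t * (Q 0 * R 0) * (X t)⁻¹) * Q t := by simp only [Matrix.mul_assoc]
      _ = 1 := by rw [h1, Matrix.mul_one, hXi, Matrix.mul_one, h2]
  have key : ∀ (M : Matrix ι ι ℝ) (t s : ℝ), R t * X t * Q 0 * (R 0 * M * Q 0) *
      (R s * X s * Q 0)⁻¹ = R t * (X t * M * (X s)⁻¹) * Q s := fun M t s => by
    rw [Matrix.inv_eq_right_inv (hY s)]
    calc R t * X t * Q 0 * (R 0 * M * Q 0) * (R 0 * (X s)⁻¹ * Q s)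
        = R t * (X t * (Q 0 * R 0) * M * (Q 0 * R 0) * (X s)⁻¹) * Q s := by
          simp only [Matrix.mul_assoc]
      _ = _ := by simp only [h1, Matrix.mul_one]
  refine ⟨fun t => R t * X t * Q 0, ⟨fun t => ?_, fun t => Matrix.isUnit_of_mul_eq_one (hY t)⟩,
    R 0 * P * Q 0, C * K * C + 1, α, ?_⟩
  · refine (((h4 t).rectMatrix_mul (hX.1 t)).rectMatrix_mul
      (hasDerivAt_const t (Q 0))).congr_deriv ?_
    simp only [Matrix.sub_mul, Matrix.mul_assoc, Matrix.add_mul, Matrix.mul_zero]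
    abel
  · refine IsDichotomy.transfer (X := X) (P := P) ⟨hP.1, hP.2⟩ ?_ (fun t => (hC t).2)
      (fun t => (hC t).1) (key P) fun t s => ?_
    · calc R 0 * P * Q 0 * (R 0 * P * Q 0) = R 0 * (P * (Q 0 * R 0) * P) * Q 0 := by
            simp only [Matrix.mul_assoc]
        _ = _ := by rw [h1, Matrix.mul_one, hP.1]
    · rw [← key, Matrix.mul_sub (R 0), Matrix.sub_mul (R 0 * 1), Matrix.mul_one, h2]

theorem KinematicallySimilar.spectrum_eq {A : ℝ → Matrix ι ι ℝ} {B : ℝ → Matrix κ κ ℝ}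
    (h : KinematicallySimilar A B) : expDichotomySpectrum A = expDichotomySpectrum B := by
  ext c
  exact not_congr ⟨(h.sub_smul_one c).hasExpDichotomy, (h.sub_smul_one c).symm.hasExpDichotomy⟩

/-- Renumbering the coordinates is a kinematic similarity, with a constant change of variables. -/
theorem KinematicallySimilar.submatrix (A : ℝ → Matrix ι ι ℝ) (e : κ ≃ ι) :
    KinematicallySimilar A (fun t => (A t).submatrix e e) := by
  refine ⟨fun _ => (1 : Matrix ι ι ℝ).submatrix id e, fun _ => (1 : Matrix ι ι ℝ).submatrix e id,
    fun t => ?_, fun t => ?_, fun t => ?_, fun t => ?_,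
    max ‖(1 : Matrix ι ι ℝ).submatrix id e‖ ‖(1 : Matrix ι ι ℝ).submatrix e id‖,
    fun t => ⟨le_max_left _ _, le_max_right _ _⟩⟩
  · rw [Matrix.submatrix_mul_equiv]; simp
  · simpa using (Matrix.submatrix_mul_equiv (1 : Matrix ι ι ℝ) (1 : Matrix ι ι ℝ) e
      (Equiv.refl ι) e)
  · refine (hasDerivAt_const t _).congr_deriv ?_
    have h1 : A t * (1 : Matrix ι ι ℝ).submatrix id e = (A t).submatrix id e := by
      simpa using (Matrix.submatrix_mul_equiv (A t) (1 : Matrix ι ι ℝ) id (Equiv.refl ι) e)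
    have h2 : (1 : Matrix ι ι ℝ).submatrix id e * (A t).submatrix e e = (A t).submatrix id e := by
      simp
    rw [h1, h2, sub_self]
  · refine (hasDerivAt_const t _).congr_deriv ?_
    have h1 : (1 : Matrix ι ι ℝ).submatrix e id * A t = (A t).submatrix e id := by
      simpa using (Matrix.submatrix_mul_equiv (1 : Matrix ι ι ℝ) (A t) e (Equiv.refl ι) id)
    have h2 : (A t).submatrix e e * (1 : Matrix ι ι ℝ).submatrix e id = (A t).submatrix e id := by
      simp
    rw [h1, h2, sub_self]

end Transfer

/-! ### Block diagonal systems -/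

section Blocks

theorem Matrix.fromBlocks_diag_sub {m₁ m₂ n₁ n₂ : Type*} (M M' : Matrix m₁ n₁ ℝ)
    (N N' : Matrix m₂ n₂ ℝ) :
    fromBlocks M 0 0 N - fromBlocks M' 0 0 N' = fromBlocks (M - M') 0 0 (N - N') := by
  ext (i | i) (j | j) <;> simp

variable {m₁ m₂ n₁ n₂ : Type*} [Fintype m₁] [DecidableEq m₁] [Fintype m₂] [DecidableEq m₂]
  [Fintype n₁] [DecidableEq n₁] [Fintype n₂] [DecidableEq n₂]

theorem Matrix.fromBlocks_sub_smul_one {m₁ m₂ : Type*} [DecidableEq m₁] [DecidableEq m₂]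
    (M : Matrix m₁ m₁ ℝ) (N : Matrix m₂ m₂ ℝ) (c : ℝ) :
    fromBlocks M 0 0 N - c • (1 : Matrix (m₁ ⊕ m₂) (m₁ ⊕ m₂) ℝ) =
      fromBlocks (M - c • (1 : Matrix m₁ m₁ ℝ)) 0 0 (N - c • (1 : Matrix m₂ m₂ ℝ)) := by
  rw [← Matrix.fromBlocks_one, Matrix.fromBlocks_smul, smul_zero, smul_zero,
    Matrix.fromBlocks_diag_sub]

theorem Matrix.fromCols_eq_add {l : Type*} (M : Matrix l n₁ ℝ) (N : Matrix l n₂ ℝ) :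
    fromCols M N = M * fromCols (1 : Matrix n₁ n₁ ℝ) (0 : Matrix n₁ n₂ ℝ) +
      N * fromCols (0 : Matrix n₂ n₁ ℝ) (1 : Matrix n₂ n₂ ℝ) := by
  ext i (j | j) <;> simp [Matrix.mul_fromCols]

theorem Matrix.fromRows_eq_add {l : Type*} (M : Matrix n₁ l ℝ) (N : Matrix n₂ l ℝ) :
    fromRows M N = fromRows (1 : Matrix n₁ n₁ ℝ) (0 : Matrix n₂ n₁ ℝ) * M +
      fromRows (0 : Matrix n₁ n₂ ℝ) (1 : Matrix n₂ n₂ ℝ) * N := by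
  ext (i | i) j <;> simp [Matrix.fromRows_mul]

theorem HasDerivAt.fromCols {l : Type*} [Fintype l] {F : ℝ → Matrix l n₁ ℝ}
    {G : ℝ → Matrix l n₂ ℝ} {F' : Matrix l n₁ ℝ} {G' : Matrix l n₂ ℝ} {t : ℝ}
    (hF : HasDerivAt F F' t) (hG : HasDerivAt G G' t) :
    HasDerivAt (fun t => Matrix.fromCols (F t) (G t)) (Matrix.fromCols F' G') t := by
  rw [funext fun t => Matrix.fromCols_eq_add (F t) (G t), Matrix.fromCols_eq_add F' G']
  refine ((hF.rectMatrix_mul (hasDerivAt_const t _)).add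
    (hG.rectMatrix_mul (hasDerivAt_const t _))).congr_deriv ?_
  simp only [Matrix.mul_zero, zero_add]

theorem HasDerivAt.fromRows {l : Type*} [Fintype l] [DecidableEq l] {F : ℝ → Matrix n₁ l ℝ}
    {G : ℝ → Matrix n₂ l ℝ} {F' : Matrix n₁ l ℝ} {G' : Matrix n₂ l ℝ} {t : ℝ}
    (hF : HasDerivAt F F' t) (hG : HasDerivAt G G' t) :
    HasDerivAt (fun t => Matrix.fromRows (F t) (G t)) (Matrix.fromRows F' G') t := by
  rw [funext fun t => Matrix.fromRows_eq_add (F t) (G t), Matrix.fromRows_eq_add F' G']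
  refine (((hasDerivAt_const t _).rectMatrix_mul hF).add
    ((hasDerivAt_const t _).rectMatrix_mul hG)).congr_deriv ?_
  simp only [Matrix.zero_mul, add_zero]

theorem HasDerivAt.fromBlocks_diag {F : ℝ → Matrix m₁ n₁ ℝ}
    {G : ℝ → Matrix m₂ n₂ ℝ} {F' : Matrix m₁ n₁ ℝ} {G' : Matrix m₂ n₂ ℝ} {t : ℝ}
    (hF : HasDerivAt F F' t) (hG : HasDerivAt G G' t) :
    HasDerivAt (fun t => Matrix.fromBlocks (F t) 0 0 (G t)) (Matrix.fromBlocks F' 0 0 G') t := by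
  simp only [← Matrix.fromRows_fromCols_eq_fromBlocks]
  exact (hF.fromCols (hasDerivAt_const t _)).fromRows ((hasDerivAt_const t _).fromCols hG)

/-- The norm of a block diagonal matrix is bounded, up to a constant depending only on the block
sizes, by the norms of its blocks. -/
theorem Matrix.exists_norm_fromBlocks_le (m₁ m₂ n₁ n₂ : Type*) [Fintype m₁] [DecidableEq m₁]
    [Fintype m₂] [DecidableEq m₂] [Fintype n₁] [DecidableEq n₁] [Fintype n₂] [DecidableEq n₂] :
    ∃ C : ℝ, 0 ≤ C ∧ ∀ (M : Matrix m₁ n₁ ℝ) (N : Matrix m₂ n₂ ℝ),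
      ‖fromBlocks M 0 0 N‖ ≤ C * (‖M‖ + ‖N‖) := by
  let J₁ : Matrix (m₁ ⊕ m₂) m₁ ℝ := fromRows 1 0
  let J₂ : Matrix (m₁ ⊕ m₂) m₂ ℝ := fromRows 0 1
  let I₁ : Matrix n₁ (n₁ ⊕ n₂) ℝ := fromCols 1 0
  let I₂ : Matrix n₂ (n₁ ⊕ n₂) ℝ := fromCols 0 1
  refine ⟨‖J₁‖ * ‖I₁‖ + ‖J₂‖ * ‖I₂‖, by positivity, fun M N => ?_⟩
  have h : fromBlocks M 0 0 N = J₁ * M * I₁ + J₂ * N * I₂ := by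
    ext (i | i) (j | j) <;> simp [J₁, J₂, I₁, I₂, Matrix.mul_fromCols, Matrix.fromRows_mul]
  have a1 : 0 ≤ ‖J₁‖ * ‖I₁‖ := by positivity
  have a2 : 0 ≤ ‖J₂‖ * ‖I₂‖ := by positivity
  calc _ ≤ ‖J₁‖ * ‖M‖ * ‖I₁‖ + ‖J₂‖ * ‖N‖ * ‖I₂‖ := by
        rw [h]
        exact (norm_add_le _ _).trans (add_le_add (Matrix.l2_opNorm_mul₃ _ _ _)
          (Matrix.l2_opNorm_mul₃ _ _ _))
    _ ≤ _ := by nlinarith [norm_nonneg M, norm_nonneg N]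

theorem KinematicallySimilar.fromBlocks {A : ℝ → Matrix m₁ m₁ ℝ} {B : ℝ → Matrix n₁ n₁ ℝ}
    (D : ℝ → Matrix m₂ m₂ ℝ) (h : KinematicallySimilar A B) :
    KinematicallySimilar (fun t => Matrix.fromBlocks (D t) 0 0 (A t))
      (fun t => Matrix.fromBlocks (D t) 0 0 (B t)) := by
  obtain ⟨Q, R, h1, h2, h3, h4, C, hC⟩ := h
  obtain ⟨c₁, hc₁, hn₁⟩ := Matrix.exists_norm_fromBlocks_le m₂ m₁ m₂ n₁
  obtain ⟨c₂, hc₂, hn₂⟩ := Matrix.exists_norm_fromBlocks_le m₂ n₁ m₂ m₁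
  have hC0 : 0 ≤ C := (norm_nonneg _).trans (hC 0).1
  refine ⟨fun t => Matrix.fromBlocks 1 0 0 (Q t), fun t => Matrix.fromBlocks 1 0 0 (R t),
    fun t => ?_, fun t => ?_, fun t => ?_, fun t => ?_,
    (c₁ + c₂) * (‖(1 : Matrix m₂ m₂ ℝ)‖ + C), fun t => ⟨?_, ?_⟩⟩
  · simp [Matrix.fromBlocks_multiply, h1]
  · simp [Matrix.fromBlocks_multiply, h2]
  · refine ((hasDerivAt_const t _).fromBlocks_diag (h3 t)).congr_deriv ?_
    simp [Matrix.fromBlocks_multiply, Matrix.fromBlocks_diag_sub]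
  · refine ((hasDerivAt_const t _).fromBlocks_diag (h4 t)).congr_deriv ?_
    simp [Matrix.fromBlocks_multiply, Matrix.fromBlocks_diag_sub]
  · refine (hn₁ _ _).trans ?_
    gcongr
    · linarith
    · exact (hC t).1
  · refine (hn₂ _ _).trans ?_
    gcongr
    · linarith
    · exact (hC t).2

theorem Matrix.fromBlocks_diag_inv {M : Matrix m₁ m₁ ℝ} {N : Matrix m₂ m₂ ℝ} (hM : IsUnit M)
    (hN : IsUnit N) : (fromBlocks M 0 0 N)⁻¹ = fromBlocks M⁻¹ 0 0 N⁻¹ :=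
  Matrix.inv_eq_right_inv (by
    simp [Matrix.fromBlocks_multiply, Matrix.mul_inv_of_isUnit hM, Matrix.mul_inv_of_isUnit hN])

theorem IsFundamentalMatrix.fromBlocks {A X : ℝ → Matrix m₁ m₁ ℝ} {B Y : ℝ → Matrix m₂ m₂ ℝ}
    (hX : IsFundamentalMatrix A X) (hY : IsFundamentalMatrix B Y) :
    IsFundamentalMatrix (fun t => Matrix.fromBlocks (A t) 0 0 (B t))
      (fun t => Matrix.fromBlocks (X t) 0 0 (Y t)) := by
  refine ⟨fun t => ((hX.1 t).fromBlocks_diag (hY.1 t)).congr_deriv ?_, fun t => ?_⟩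
  · simp [Matrix.fromBlocks_multiply]
  · refine Matrix.isUnit_of_mul_eq_one (N := Matrix.fromBlocks (X t)⁻¹ 0 0 (Y t)⁻¹) ?_
    simp [Matrix.fromBlocks_multiply, Matrix.mul_inv_of_isUnit (hX.2 t),
      Matrix.mul_inv_of_isUnit (hY.2 t)]

theorem HasExpDichotomy.fromBlocks {A : ℝ → Matrix m₁ m₁ ℝ} {B : ℝ → Matrix m₂ m₂ ℝ}
    (hA : HasExpDichotomy A) (hB : HasExpDichotomy B) :
    HasExpDichotomy (fun t => Matrix.fromBlocks (A t) 0 0 (B t)) := by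
  obtain ⟨X, hX, P, K, α, hP, hK, hα, a1, a2⟩ := hA
  obtain ⟨Y, hY, P', K', α', hP', hK', hα', b1, b2⟩ := hB
  obtain ⟨c, hc, hn⟩ := Matrix.exists_norm_fromBlocks_le m₁ m₂ m₁ m₂
  have one_sub : (1 : Matrix (m₁ ⊕ m₂) (m₁ ⊕ m₂) ℝ) - Matrix.fromBlocks P 0 0 P' =
      Matrix.fromBlocks (1 - P) 0 0 (1 - P') := by
    rw [← Matrix.fromBlocks_one, Matrix.fromBlocks_diag_sub]
  have bound : ∀ (R : Matrix m₁ m₁ ℝ) (R' : Matrix m₂ m₂ ℝ) (t s x : ℝ), 0 ≤ x →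
      ‖X t * R * (X s)⁻¹‖ ≤ K * Real.exp (-α * x) →
      ‖Y t * R' * (Y s)⁻¹‖ ≤ K' * Real.exp (-α' * x) →
      ‖Matrix.fromBlocks (X t) 0 0 (Y t) * Matrix.fromBlocks R 0 0 R' *
        (Matrix.fromBlocks (X s) 0 0 (Y s))⁻¹‖ ≤
        (c * (K + K') + 1) * Real.exp (-(min α α') * x) := by
    intro R R' t s x hx h1 h2
    rw [Matrix.fromBlocks_diag_inv (hX.2 s) (hY.2 s)]
    simp only [Matrix.fromBlocks_multiply, Matrix.mul_zero, Matrix.zero_mul, add_zero, zero_add]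
    have e1 : Real.exp (-α * x) ≤ Real.exp (-(min α α') * x) :=
      Real.exp_le_exp.2 (mul_le_mul_of_nonneg_right (neg_le_neg (min_le_left _ _)) hx)
    have e2 : Real.exp (-α' * x) ≤ Real.exp (-(min α α') * x) :=
      Real.exp_le_exp.2 (mul_le_mul_of_nonneg_right (neg_le_neg (min_le_right _ _)) hx)
    calc _ ≤ c * (‖X t * R * (X s)⁻¹‖ + ‖Y t * R' * (Y s)⁻¹‖) := hn _ _
      _ ≤ c * (K * Real.exp (-(min α α') * x) + K' * Real.exp (-(min α α') * x)) := by
          gcongr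
          · exact h1.trans (by gcongr)
          · exact h2.trans (by gcongr)
      _ ≤ _ := by nlinarith [Real.exp_pos (-(min α α') * x)]
  refine ⟨_, hX.fromBlocks hY, Matrix.fromBlocks P 0 0 P', c * (K + K') + 1, min α α', ?_,
    by positivity, lt_min hα hα', fun t s hts => ?_, fun t s hts => ?_⟩
  · simp [Matrix.fromBlocks_multiply, hP, hP']
  · exact bound _ _ _ _ _ (by linarith) (a1 t s hts) (b1 t s hts)
  · rw [one_sub]
    exact bound _ _ _ _ _ (by linarith) (a2 t s hts) (b2 t s hts)

/-- The reflection `diag(1, -1)` commutes with a block diagonal fundamental matrix, so it conjugates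
a dichotomy projection to a dichotomy projection; by uniqueness the two coincide, and the
projection is block diagonal. -/
theorem IsDichotomy.eq_fromBlocks {X : ℝ → Matrix m₁ m₁ ℝ} {Y : ℝ → Matrix m₂ m₂ ℝ}
    (hX : ∀ t, IsUnit (X t)) (hY : ∀ t, IsUnit (Y t)) {P : Matrix (m₁ ⊕ m₂) (m₁ ⊕ m₂) ℝ} {K α : ℝ}
    (h : IsDichotomy (fun t => Matrix.fromBlocks (X t) 0 0 (Y t)) P K α) :
    ∃ P₁ P₂, P = Matrix.fromBlocks P₁ 0 0 P₂ := by
  let S : Matrix (m₁ ⊕ m₂) (m₁ ⊕ m₂) ℝ := Matrix.fromBlocks 1 0 0 (-1)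
  have hS : S * S = 1 := by simp [S, Matrix.fromBlocks_multiply]
  have hcomm : ∀ (M : Matrix m₁ m₁ ℝ) (N : Matrix m₂ m₂ ℝ),
      Matrix.fromBlocks M 0 0 N * S = S * Matrix.fromBlocks M 0 0 N := by
    intro M N; simp [S, Matrix.fromBlocks_multiply]
  have hU : ∀ t, IsUnit (Matrix.fromBlocks (X t) 0 0 (Y t)) := fun t => by
    refine Matrix.isUnit_of_mul_eq_one (N := Matrix.fromBlocks (X t)⁻¹ 0 0 (Y t)⁻¹) ?_
    simp [Matrix.fromBlocks_multiply, Matrix.mul_inv_of_isUnit (hX t),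
      Matrix.mul_inv_of_isUnit (hY t)]
  have key : ∀ (R : Matrix (m₁ ⊕ m₂) (m₁ ⊕ m₂) ℝ) (t s : ℝ),
      Matrix.fromBlocks (X t) 0 0 (Y t) * (S * R * S) * (Matrix.fromBlocks (X s) 0 0 (Y s))⁻¹ =
      S * (Matrix.fromBlocks (X t) 0 0 (Y t) * R * (Matrix.fromBlocks (X s) 0 0 (Y s))⁻¹) * S := by
    intro R t s
    rw [Matrix.fromBlocks_diag_inv (hX s) (hY s)]
    calc _ = Matrix.fromBlocks (X t) 0 0 (Y t) * S * R *
          (S * Matrix.fromBlocks (X s)⁻¹ 0 0 (Y s)⁻¹) := by simp only [Matrix.mul_assoc]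
      _ = _ := by rw [hcomm, ← hcomm (X s)⁻¹]; simp only [Matrix.mul_assoc]
  have h' : IsDichotomy (fun t => Matrix.fromBlocks (X t) 0 0 (Y t)) (S * P * S)
      (‖S‖ * K * ‖S‖ + 1) α := by
    refine h.transfer (L := fun _ => S) (R := fun _ => S) (C := ‖S‖) ?_ (fun _ => le_rfl)
      (fun _ => le_rfl) (key P) fun t s => ?_
    · calc S * P * S * (S * P * S) = S * (P * (S * S) * P) * S := by simp only [Matrix.mul_assoc]
        _ = _ := by rw [hS, Matrix.mul_one, h.1]
    · rw [← key, Matrix.mul_sub S, Matrix.sub_mul (S * 1), Matrix.mul_one, hS]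
  have hP := h.projection_unique hU h'
  obtain ⟨a, b, c, d, rfl⟩ : ∃ a b c d, P = Matrix.fromBlocks a b c d :=
    ⟨_, _, _, _, (Matrix.fromBlocks_toBlocks P).symm⟩
  simp only [S, Matrix.fromBlocks_multiply, Matrix.fromBlocks_inj, Matrix.mul_zero, Matrix.zero_mul,
    Matrix.one_mul, Matrix.mul_one, add_zero, zero_add, Matrix.mul_neg, Matrix.neg_mul] at hP
  refine ⟨a, d, ?_⟩
  have hb : b = 0 := by
    ext i j
    have h := congrFun (congrFun hP.2.1 i) j
    rw [Matrix.neg_apply] at h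
    rw [Matrix.zero_apply]; linarith
  have hc : c = 0 := by
    ext i j
    have h := congrFun (congrFun hP.2.2.1 i) j
    rw [Matrix.neg_apply] at h
    rw [Matrix.zero_apply]; linarith
  rw [hb, hc]

/-- Each block inherits a dichotomy, because the projection of the direct sum is block diagonal. -/
theorem HasExpDichotomy.of_fromBlocks {A X : ℝ → Matrix m₁ m₁ ℝ} {B Y : ℝ → Matrix m₂ m₂ ℝ}
    (hX : IsFundamentalMatrix A X) (hY : IsFundamentalMatrix B Y)
    (h : HasExpDichotomy (fun t => Matrix.fromBlocks (A t) 0 0 (B t))) :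
    HasExpDichotomy A ∧ HasExpDichotomy B := by
  obtain ⟨P, K, α, hP⟩ := h.exists_isDichotomy (hX.fromBlocks hY)
  obtain ⟨P₁, P₂, rfl⟩ := hP.eq_fromBlocks hX.2 hY.2
  have one_sub : (1 : Matrix (m₁ ⊕ m₂) (m₁ ⊕ m₂) ℝ) - Matrix.fromBlocks P₁ 0 0 P₂ =
      Matrix.fromBlocks (1 - P₁) 0 0 (1 - P₂) := by
    rw [← Matrix.fromBlocks_one, Matrix.fromBlocks_diag_sub]
  have idem := hP.1
  simp only [Matrix.fromBlocks_multiply, Matrix.fromBlocks_inj, Matrix.mul_zero, Matrix.zero_mul,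
    add_zero, zero_add] at idem
  constructor
  · refine ⟨X, hX, P₁, _, α, hP.transfer (L := fun _ => Matrix.fromCols 1 0)
      (R := fun _ => Matrix.fromRows 1 0)
      (C := max ‖(Matrix.fromCols 1 0 : Matrix m₁ (m₁ ⊕ m₂) ℝ)‖
        ‖(Matrix.fromRows 1 0 : Matrix (m₁ ⊕ m₂) m₁ ℝ)‖) idem.1 (fun _ => le_max_left _ _)
      (fun _ => le_max_right _ _) (fun t s => ?_) fun t s => ?_⟩
    all_goals
      simp only [one_sub, Matrix.fromBlocks_diag_inv (hX.2 s) (hY.2 s), Matrix.fromBlocks_multiply,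
        Matrix.mul_zero, Matrix.zero_mul, add_zero, zero_add, Matrix.fromCols_mul_fromBlocks,
        Matrix.fromCols_mul_fromRows, Matrix.one_mul, Matrix.mul_one]
  · refine ⟨Y, hY, P₂, _, α, hP.transfer (L := fun _ => Matrix.fromCols 0 1)
      (R := fun _ => Matrix.fromRows 0 1)
      (C := max ‖(Matrix.fromCols 0 1 : Matrix m₂ (m₁ ⊕ m₂) ℝ)‖
        ‖(Matrix.fromRows 0 1 : Matrix (m₁ ⊕ m₂) m₂ ℝ)‖) idem.2.2.2 (fun _ => le_max_left _ _)
      (fun _ => le_max_right _ _) (fun t s => ?_) fun t s => ?_⟩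
    all_goals
      simp only [one_sub, Matrix.fromBlocks_diag_inv (hX.2 s) (hY.2 s), Matrix.fromBlocks_multiply,
        Matrix.mul_zero, Matrix.zero_mul, add_zero, zero_add, Matrix.fromCols_mul_fromBlocks,
        Matrix.fromCols_mul_fromRows, Matrix.one_mul, Matrix.mul_one]

/-- The spectrum of a direct sum is the union of the spectra. Fundamental matrices of the summands
are hypotheses, so that no existence theorem for linear systems is needed: a dichotomy provides them. -/
theorem expDichotomySpectrum_fromBlocks {A X : ℝ → Matrix m₁ m₁ ℝ} {B Y : ℝ → Matrix m₂ m₂ ℝ}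
    (hX : IsFundamentalMatrix A X) (hY : IsFundamentalMatrix B Y) :
    expDichotomySpectrum (fun t => Matrix.fromBlocks (A t) 0 0 (B t)) =
      expDichotomySpectrum A ∪ expDichotomySpectrum B := by
  ext c
  simp only [expDichotomySpectrum, Set.mem_ofPred_eq, Set.mem_union,
    Matrix.fromBlocks_sub_smul_one, ← not_and_or]
  exact not_congr ⟨HasExpDichotomy.of_fromBlocks (hX.sub_smul_one c) (hY.sub_smul_one c),
    fun h => h.1.fromBlocks h.2⟩

end Blocks

/-! ### Gram–Schmidt for continuously differentiable matrix families -/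

section GramSchmidt

variable {m n : Type*} [Fintype m] [DecidableEq m] [Fintype n] [DecidableEq n]

theorem contDiff_one_matrix_iff {F : ℝ → Matrix m n ℝ} :
    ContDiff ℝ 1 F ↔ ∀ i j, ContDiff ℝ 1 fun t => F t i j := by
  constructor
  · intro h i j
    exact (LinearMap.toContinuousLinearMap (Matrix.entryLinearMap ℝ ℝ i j)).contDiff.comp h
  · intro h
    have e : F = fun t => ∑ i, ∑ j, F t i j • Matrix.single i j (1 : ℝ) := by
      funext t
      conv_lhs => rw [Matrix.matrix_eq_sum_single (F t)]
      simp [Matrix.smul_single]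
    rw [e]
    exact ContDiff.sum fun i _ => ContDiff.sum fun j _ => (h i j).smul contDiff_const

theorem InnerProductSpace.contDiff_gramSchmidt {E : Type*} [NormedAddCommGroup E]
    [InnerProductSpace ℝ E] {p : ℕ} {v : ℝ → Fin p → E} (hv : ∀ j, ContDiff ℝ 1 fun t => v t j)
    (hli : ∀ t, LinearIndependent ℝ (v t)) (j : Fin p) :
    ContDiff ℝ 1 fun t => gramSchmidt ℝ (v t) j := by
  induction j using WellFoundedLT.induction with
  | ind j ih =>
    simp only [gramSchmidt_def ℝ _ j, Submodule.starProjection_singleton]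
    refine (hv j).sub (ContDiff.sum fun i hi => ContDiff.smul (ContDiff.div ?_ ?_ ?_) ?_)
    · exact (ih i (Finset.mem_Iio.1 hi)).inner ℝ (hv j)
    · exact (ih i (Finset.mem_Iio.1 hi)).norm_sq ℝ
    · intro t
      have := gramSchmidt_ne_zero (𝕜 := ℝ) i (hli t)
      simpa using this
    · exact ih i (Finset.mem_Iio.1 hi)

open InnerProductSpace in
/-- The triangular factor of the `QR` decomposition of a continuously differentiable family of
injective matrices is continuously differentiable: Gram–Schmidt involves only rational operations
and square roots of positive quantities. -/
theorem exists_contDiff_factor_gram {p : ℕ} {U : ℝ → Matrix m (Fin p) ℝ} (hU : ContDiff ℝ 1 U)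
    {L : ℝ → Matrix (Fin p) m ℝ} (hL : ∀ t, L t * U t = 1) :
    ∃ R : ℝ → Matrix (Fin p) (Fin p) ℝ, ContDiff ℝ 1 R ∧
      ∀ t, IsUnit (R t) ∧ (R t).transpose * R t = (U t).transpose * U t := by
  have hker : ∀ t x, (U t).mulVec x = 0 → x = 0 := fun t x hx => by
    rw [← Matrix.one_mulVec x, ← hL t, ← Matrix.mulVec_mulVec, hx, Matrix.mulVec_zero]
  let v : ℝ → Fin p → EuclideanSpace ℝ m := fun t j => WithLp.toLp 2 fun i => U t i j
  have hv : ∀ j, ContDiff ℝ 1 fun t => v t j := fun j =>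
    contDiff_euclidean.2 fun i => contDiff_one_matrix_iff.1 hU i j
  have hli : ∀ t, LinearIndependent ℝ (v t) := fun t => by
    rw [Fintype.linearIndependent_iff]
    intro g hg
    have : g = 0 := hker t g (by
      funext i
      have := congrArg (fun w : EuclideanSpace ℝ m => w i) hg
      simpa [v, Matrix.mulVec, dotProduct, mul_comm] using this)
    exact fun i => congrFun this i
  have hinner : ∀ t j k, inner ℝ (v t j) (v t k) = ((U t).transpose * U t) j k := fun t j k => by
    simp [v, Matrix.mul_apply, PiLp.inner_apply, mul_comm]
  let e : ℝ → Fin p → EuclideanSpace ℝ m := fun t => gramSchmidtNormed ℝ (v t)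
  have he : ∀ i, ContDiff ℝ 1 fun t => e t i := fun i => by
    have h := contDiff_gramSchmidt hv hli i
    have hne : ∀ t, gramSchmidt ℝ (v t) i ≠ 0 := fun t => gramSchmidt_ne_zero (𝕜 := ℝ) i (hli t)
    exact ((h.norm ℝ hne).inv fun t => norm_ne_zero_iff.2 (hne t)).smul h
  have hon : ∀ t, Orthonormal ℝ (e t) := fun t => gramSchmidtNormed_orthonormal (hli t)
  have hexp : ∀ t k, v t k = ∑ i, inner ℝ (e t i) (v t k) • e t i := fun t k => by
    have hmem : v t k ∈ Submodule.span ℝ (Set.range (e t)) := by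
      rw [span_gramSchmidtNormed_range, span_gramSchmidt]
      exact Submodule.subset_span ⟨k, rfl⟩
    obtain ⟨c, hc⟩ := (Submodule.mem_span_range_iff_exists_fun ℝ).1 hmem
    have : ∀ i, inner ℝ (e t i) (v t k) = c i := fun i => by
      rw [← hc, (hon t).inner_right_fintype]
    simp only [this, hc]
  have hgram : ∀ t, (Matrix.of fun i j => inner ℝ (e t i) (v t j)).transpose *
      (Matrix.of fun i j => inner ℝ (e t i) (v t j)) = (U t).transpose * U t := fun t => by
    ext j k
    rw [← hinner, hexp t k, inner_sum]
    simp only [Matrix.mul_apply, Matrix.transpose_apply, Matrix.of_apply, inner_smul_right]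
    refine Finset.sum_congr rfl fun i _ => ?_
    rw [real_inner_comm (v t j), mul_comm]
  refine ⟨fun t => Matrix.of fun i j => inner ℝ (e t i) (v t j),
    contDiff_one_matrix_iff.2 fun i j => (he i).inner ℝ (hv j), fun t => ⟨?_, hgram t⟩⟩
  rw [← Matrix.mulVec_injective_iff_isUnit]
  refine (injective_iff_map_eq_zero (Matrix.mulVecLin _)).2 fun x hx => hker t x ?_
  rw [← Matrix.conjTranspose_mul_self_mulVec_eq_zero, Matrix.conjTranspose_eq_transpose_of_trivial,
    ← hgram t, ← Matrix.mulVec_mulVec]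
  rw [Matrix.mulVecLin_apply] at hx
  rw [hx, Matrix.mulVec_zero]

/-- A projection matrix factors through coordinates on its range. -/
theorem Matrix.exists_factor_of_idempotent {P : Matrix n n ℝ} (hP : P * P = P) :
    ∃ (p : ℕ) (V : Matrix n (Fin p) ℝ) (W : Matrix (Fin p) n ℝ), V * W = P ∧ W * V = 1 := by
  let f : (n → ℝ) →ₗ[ℝ] (n → ℝ) := Matrix.toLin' P
  let b := Module.finBasis ℝ (LinearMap.range f)
  let g : (Fin _ → ℝ) →ₗ[ℝ] (n → ℝ) := (LinearMap.range f).subtype ∘ₗ b.equivFun.symm.toLinearMap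
  let h : (n → ℝ) →ₗ[ℝ] (Fin _ → ℝ) := b.equivFun.toLinearMap ∘ₗ f.rangeRestrict
  have hgh : g ∘ₗ h = f := by
    ext x; simp [g, h]
  have hff : ∀ x, f (f x) = f x := fun x => by
    simp only [f, Matrix.toLin'_apply, Matrix.mulVec_mulVec, hP]
  have hhg : h ∘ₗ g = LinearMap.id := by
    refine LinearMap.ext fun x => ?_
    have : f.rangeRestrict (b.equivFun.symm x : n → ℝ) = b.equivFun.symm x := by
      obtain ⟨y, hy⟩ := (b.equivFun.symm x).2
      apply Subtype.ext
      rw [← hy]; exact hff y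
    change b.equivFun (f.rangeRestrict (b.equivFun.symm x : n → ℝ)) = x
    rw [this, LinearEquiv.apply_symm_apply]
  refine ⟨_, LinearMap.toMatrix' g, LinearMap.toMatrix' h, ?_, ?_⟩
  · rw [← LinearMap.toMatrix'_comp, hgh, LinearMap.toMatrix'_toLin']
  · rw [← LinearMap.toMatrix'_comp, hhg, LinearMap.toMatrix'_id]

end GramSchmidt

/-! ### Splitting a system along a dichotomy -/

section Split

variable {ι : Type*} [Fintype ι] [DecidableEq ι]

theorem IsFundamentalMatrix.contDiff {A X : ℝ → Matrix ι ι ℝ} (hA : Continuous A)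
    (hX : IsFundamentalMatrix A X) : ContDiff ℝ 1 X := by
  have hd : Differentiable ℝ X := fun t => (hX.1 t).differentiableAt
  refine contDiff_one_iff_deriv.2 ⟨hd, ?_⟩
  rw [funext fun t => (hX.1 t).deriv]
  exact hA.mul hd.continuous

/-- An invariant family of projections `X(t) P X(t)⁻¹` which is bounded factors as `E(t) F(t)` with
`F(t) E(t) = 1` and bounded factors: `E` is the orthonormal frame which Gram–Schmidt extracts from
the solutions spanning the range. In this frame the restricted system has coefficient `B` and
fundamental matrix `Y`, the triangular Gram–Schmidt factor. -/
theorem IsFundamentalMatrix.exists_invariant_frame {A X : ℝ → Matrix ι ι ℝ} (hA : Continuous A)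
    (hX : IsFundamentalMatrix A X) {P : Matrix ι ι ℝ} (hP : P * P = P) {K : ℝ}
    (hK : ∀ t, ‖X t * P * (X t)⁻¹‖ ≤ K) :
    ∃ (p : ℕ) (B Y : ℝ → Matrix (Fin p) (Fin p) ℝ) (E : ℝ → Matrix ι (Fin p) ℝ)
      (F : ℝ → Matrix (Fin p) ι ℝ), Continuous B ∧ IsFundamentalMatrix B Y ∧
      (∀ t, HasDerivAt E (A t * E t - E t * B t) t) ∧
      (∀ t, HasDerivAt F (B t * F t - F t * A t) t) ∧
      (∀ t, F t * E t = 1) ∧ (∀ t, E t * F t = X t * P * (X t)⁻¹) ∧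
      (∃ C, ∀ t, ‖E t‖ ≤ C ∧ ‖F t‖ ≤ C) ∧
      ∀ t s, Y t * (Y s)⁻¹ = F t * (X t * P * (X s)⁻¹) * E s := by
  obtain ⟨p, V, W, hVW, hWV⟩ := Matrix.exists_factor_of_idempotent hP
  have hXC := hX.contDiff hA
  have hXi := fun t => Matrix.inv_mul_of_isUnit (hX.2 t)
  have hXi' := fun t => Matrix.mul_inv_of_isUnit (hX.2 t)
  have hUd : ∀ t, HasDerivAt (fun t => X t * V) (A t * X t * V) t := fun t =>
    ((hX.1 t).rectMatrix_mul (hasDerivAt_const t V)).congr_deriv (by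
      rw [Matrix.mul_zero, zero_add])
  have hUC : ContDiff ℝ 1 fun t => X t * V := by
    refine contDiff_one_iff_deriv.2 ⟨fun t => (hUd t).differentiableAt, ?_⟩
    rw [funext fun t => (hUd t).deriv]
    exact (hA.matrix_mul hXC.continuous).matrix_mul continuous_const
  obtain ⟨R, hRC, hR⟩ := exists_contDiff_factor_gram hUC (L := fun t => W * (X t)⁻¹) fun t => by
    calc W * (X t)⁻¹ * (X t * V) = W * ((X t)⁻¹ * X t) * V := by simp only [Matrix.mul_assoc]
      _ = 1 := by rw [hXi, Matrix.mul_one, hWV]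
  have hRi := fun t => Matrix.inv_mul_of_isUnit (hR t).1
  have hRi' := fun t => Matrix.mul_inv_of_isUnit (hR t).1
  have hRd : ∀ t, HasDerivAt R (deriv R t) t := fun t =>
    ((contDiff_one_iff_deriv.1 hRC).1 t).hasDerivAt
  have hFE : ∀ t, R t * W * (X t)⁻¹ * (X t * V * (R t)⁻¹) = 1 := fun t => by
    calc _ = R t * (W * ((X t)⁻¹ * X t) * V) * (R t)⁻¹ := by simp only [Matrix.mul_assoc]
      _ = 1 := by rw [hXi, Matrix.mul_one, hWV, Matrix.mul_one, hRi']
  have hEF : ∀ t, X t * V * (R t)⁻¹ * (R t * W * (X t)⁻¹) = X t * P * (X t)⁻¹ := fun t => by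
    calc _ = X t * (V * ((R t)⁻¹ * R t) * W) * (X t)⁻¹ := by simp only [Matrix.mul_assoc]
      _ = _ := by rw [hRi, Matrix.mul_one, hVW]
  -- the columns of the frame are orthonormal
  have hEE : ∀ t, (X t * V * (R t)⁻¹).conjTranspose * (X t * V * (R t)⁻¹) = 1 := fun t => by
    rw [Matrix.conjTranspose_eq_transpose_of_trivial, Matrix.transpose_mul]
    calc _ = ((R t)⁻¹).transpose * ((X t * V).transpose * (X t * V)) * (R t)⁻¹ := by
          simp only [Matrix.mul_assoc]
      _ = ((R t)⁻¹).transpose * (R t).transpose * (R t * (R t)⁻¹) := by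
          rw [← (hR t).2]; simp only [Matrix.mul_assoc]
      _ = 1 := by
          rw [hRi', ← Matrix.transpose_mul, hRi', Matrix.transpose_one, Matrix.mul_one]
  set c : ℝ := ‖(1 : Matrix (Fin p) (Fin p) ℝ)‖ with hc
  have hc0 : 0 ≤ c := norm_nonneg _
  have hE : ∀ t, ‖X t * V * (R t)⁻¹‖ ≤ c + 1 := fun t => by
    have h := Matrix.l2_opNorm_conjTranspose_mul_self (X t * V * (R t)⁻¹)
    rw [hEE, ← hc] at h
    by_contra! h'
    nlinarith
  have hF : ∀ t, ‖R t * W * (X t)⁻¹‖ ≤ (c + 1) * K := fun t => by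
    calc ‖R t * W * (X t)⁻¹‖
        = ‖(X t * V * (R t)⁻¹).conjTranspose * (X t * P * (X t)⁻¹)‖ := by
          rw [← hEF, ← Matrix.mul_assoc (X t * V * (R t)⁻¹).conjTranspose, hEE, Matrix.one_mul]
      _ ≤ ‖X t * V * (R t)⁻¹‖ * ‖X t * P * (X t)⁻¹‖ := by
          refine (Matrix.l2_opNorm_mul _ _).trans_eq ?_
          rw [Matrix.l2_opNorm_conjTranspose]
      _ ≤ (c + 1) * K := mul_le_mul (hE t) (hK t) (norm_nonneg _) (by positivity)
  refine ⟨p, fun t => deriv R t * (R t)⁻¹, R, fun t => X t * V * (R t)⁻¹,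
    fun t => R t * W * (X t)⁻¹, ?_, ⟨fun t => (hRd t).congr_deriv ?_, fun t => (hR t).1⟩,
    fun t => ?_, fun t => ?_, hFE, hEF, ⟨max (c + 1) ((c + 1) * K),
      fun t => ⟨(hE t).trans (le_max_left _ _), (hF t).trans (le_max_right _ _)⟩⟩, fun t s => ?_⟩
  · exact (contDiff_one_iff_deriv.1 hRC).2.matrix_mul
      (hRC.continuous.matrix_inv_of_isUnit fun t => (hR t).1)
  · rw [Matrix.mul_assoc, hRi, Matrix.mul_one]
  · refine ((hUd t).rectMatrix_mul ((hRd t).matrix_inv (hR t).1)).congr_deriv ?_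
    simp only [Matrix.mul_assoc, Matrix.mul_neg]
    abel
  · refine (((hRd t).rectMatrix_mul (hasDerivAt_const t W)).rectMatrix_mul
      ((hX.1 t).matrix_inv (hX.2 t))).congr_deriv ?_
    have e1 : deriv R t * (R t)⁻¹ * (R t * W * (X t)⁻¹) = deriv R t * W * (X t)⁻¹ := by
      calc _ = deriv R t * ((R t)⁻¹ * R t) * W * (X t)⁻¹ := by simp only [Matrix.mul_assoc]
        _ = _ := by rw [hRi, Matrix.mul_one]
    have e2 : (X t)⁻¹ * (A t * X t) * (X t)⁻¹ = (X t)⁻¹ * A t := by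
      rw [Matrix.mul_assoc, Matrix.mul_assoc, hXi', Matrix.mul_one]
    rw [e1, e2, Matrix.mul_zero, zero_add, Matrix.mul_neg, ← Matrix.mul_assoc]
    abel
  · calc R t * (R s)⁻¹ = R t * (W * V * (W * V)) * (R s)⁻¹ := by
          rw [hWV, Matrix.mul_one, Matrix.mul_one]
      _ = R t * W * ((X t)⁻¹ * X t) * (V * W) * ((X s)⁻¹ * X s) * V * (R s)⁻¹ := by
          rw [hXi, hXi]; simp only [Matrix.mul_assoc, Matrix.one_mul]
      _ = _ := by rw [hVW]; simp only [Matrix.mul_assoc]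

/-- A system with an exponential dichotomy is kinematically similar to the direct sum of a uniformly
exponentially stable system and a system which is so in backward time. -/
theorem HasExpDichotomy.exists_split {A : ℝ → Matrix ι ι ℝ} (hA : Continuous A)
    (h : HasExpDichotomy A) :
    ∃ (p q : ℕ) (B Y : ℝ → Matrix (Fin p) (Fin p) ℝ) (C Z : ℝ → Matrix (Fin q) (Fin q) ℝ),
      Continuous B ∧ Continuous C ∧ IsFundamentalMatrix B Y ∧ IsFundamentalMatrix C Z ∧
      KinematicallySimilar A (fun t => Matrix.fromBlocks (B t) 0 0 (C t)) ∧
      ∃ K α : ℝ, 0 < K ∧ 0 < α ∧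
        (∀ t s, s ≤ t → ‖Y t * (Y s)⁻¹‖ ≤ K * Real.exp (-α * (t - s))) ∧
        (∀ t s, t ≤ s → ‖Z t * (Z s)⁻¹‖ ≤ K * Real.exp (-α * (s - t))) := by
  obtain ⟨X, hX, P, K, α, hP, hK, hα, h1, h2⟩ := h
  have hP' : (1 - P) * (1 - P) = 1 - P := by
    rw [Matrix.mul_sub, Matrix.mul_one, Matrix.sub_mul, Matrix.one_mul, hP, sub_self, sub_zero]
  have hPP : P * (1 - P) = 0 := by rw [Matrix.mul_sub, hP, Matrix.mul_one, sub_self]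
  have hPP' : (1 - P) * P = 0 := by rw [Matrix.sub_mul, hP, Matrix.one_mul, sub_self]
  have hXi := fun t => Matrix.inv_mul_of_isUnit (hX.2 t)
  obtain ⟨p, B, Y, E, F, hB, hY, hE, hF, hFE, hEF, ⟨c, hc⟩, hYY⟩ :=
    hX.exists_invariant_frame hA hP (K := K) fun t => by simpa using h1 t t le_rfl
  obtain ⟨q, D, Z, G, H, hD, hZ, hG, hH, hHG, hGH, ⟨d, hd⟩, hZZ⟩ :=
    hX.exists_invariant_frame hA hP' (K := K) fun t => by simpa using h2 t t le_rfl
  have hc0 : 0 ≤ c := (norm_nonneg _).trans (hc 0).1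
  have hd0 : 0 ≤ d := (norm_nonneg _).trans (hd 0).1
  have prod : ∀ (R S : Matrix ι ι ℝ) (t : ℝ), R * S = 0 →
      X t * R * (X t)⁻¹ * (X t * S * (X t)⁻¹) = 0 := fun R S t hRS => by
    calc _ = X t * (R * ((X t)⁻¹ * X t) * S) * (X t)⁻¹ := by simp only [Matrix.mul_assoc]
      _ = 0 := by rw [hXi, Matrix.mul_one, hRS]; simp
  -- each coframe annihilates the other frame, as `P (1 - P) = (1 - P) P = 0`
  have hFG : ∀ t, F t * G t = 0 := fun t => by
    calc F t * G t = F t * E t * F t * (G t * (H t * G t)) := by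
          rw [hFE, hHG, Matrix.one_mul, Matrix.mul_one]
      _ = F t * (E t * F t * (G t * H t)) * G t := by simp only [Matrix.mul_assoc]
      _ = 0 := by rw [hEF, hGH, prod _ _ t hPP]; simp
  have hHE : ∀ t, H t * E t = 0 := fun t => by
    calc H t * E t = H t * G t * H t * (E t * (F t * E t)) := by
          rw [hFE, hHG, Matrix.one_mul, Matrix.mul_one]
      _ = H t * (G t * H t * (E t * F t)) * E t := by simp only [Matrix.mul_assoc]
      _ = 0 := by rw [hEF, hGH, prod _ _ t hPP']; simp
  refine ⟨p, q, B, Y, D, Z, hB, hD, hY, hZ, ⟨fun t => Matrix.fromCols (E t) (G t),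
    fun t => Matrix.fromRows (F t) (H t), fun t => ?_, fun t => ?_, fun t => ?_, fun t => ?_, ?_⟩,
    c * K * c + d * K * d + 1, α, by positivity, hα, fun t s hts => ?_, fun t s hts => ?_⟩
  · rw [Matrix.fromCols_mul_fromRows, hEF, hGH, ← Matrix.add_mul, ← Matrix.mul_add,
      add_sub_cancel, Matrix.mul_one, Matrix.mul_inv_of_isUnit (hX.2 t)]
  · rw [Matrix.fromRows_mul_fromCols, hFE, hHG, hFG, hHE, Matrix.fromBlocks_one]
  · refine ((hE t).fromCols (hG t)).congr_deriv ?_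
    rw [Matrix.mul_fromCols, Matrix.fromCols_mul_fromBlocks]
    ext i (j | j) <;> simp
  · refine ((hF t).fromRows (hH t)).congr_deriv ?_
    rw [Matrix.fromRows_mul, Matrix.fromBlocks_mul_fromRows]
    ext (i | i) j <;> simp
  · let J₁ : Matrix (Fin p) (Fin p ⊕ Fin q) ℝ := Matrix.fromCols 1 0
    let J₂ : Matrix (Fin q) (Fin p ⊕ Fin q) ℝ := Matrix.fromCols 0 1
    let I₁ : Matrix (Fin p ⊕ Fin q) (Fin p) ℝ := Matrix.fromRows 1 0
    let I₂ : Matrix (Fin p ⊕ Fin q) (Fin q) ℝ := Matrix.fromRows 0 1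
    refine ⟨max (c * ‖J₁‖ + d * ‖J₂‖) (‖I₁‖ * c + ‖I₂‖ * d), fun t => ⟨?_, ?_⟩⟩
    · refine le_trans ?_ (le_max_left _ _)
      rw [Matrix.fromCols_eq_add]
      refine (norm_add_le _ _).trans (add_le_add ?_ ?_)
      · exact (Matrix.l2_opNorm_mul _ _).trans
          (mul_le_mul_of_nonneg_right (hc t).1 (norm_nonneg _))
      · exact (Matrix.l2_opNorm_mul _ _).trans
          (mul_le_mul_of_nonneg_right (hd t).1 (norm_nonneg _))
    · refine le_trans ?_ (le_max_right _ _)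
      rw [Matrix.fromRows_eq_add]
      refine (norm_add_le _ _).trans (add_le_add ?_ ?_)
      · exact (Matrix.l2_opNorm_mul _ _).trans
          (mul_le_mul_of_nonneg_left (hc t).2 (norm_nonneg _))
      · exact (Matrix.l2_opNorm_mul _ _).trans
          (mul_le_mul_of_nonneg_left (hd t).2 (norm_nonneg _))
  · rw [hYY]
    calc _ ≤ ‖F t‖ * ‖X t * P * (X s)⁻¹‖ * ‖E s‖ := Matrix.l2_opNorm_mul₃ _ _ _
      _ ≤ c * (K * Real.exp (-α * (t - s))) * c := by
          gcongr
          · exact (hc t).2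
          · exact h1 t s hts
          · exact (hc s).1
      _ = c * K * c * Real.exp (-α * (t - s)) := by ring
      _ ≤ _ := by
          gcongr
          have : 0 ≤ d * K * d := by positivity
          linarith
  · rw [hZZ]
    calc _ ≤ ‖H t‖ * ‖X t * (1 - P) * (X s)⁻¹‖ * ‖G s‖ := Matrix.l2_opNorm_mul₃ _ _ _
      _ ≤ d * (K * Real.exp (-α * (s - t))) * d := by
          gcongr
          · exact (hd t).2
          · exact h2 t s hts
          · exact (hd s).1
      _ = d * K * d * Real.exp (-α * (s - t)) := by ring
      _ ≤ _ := by
          gcongr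
          have : 0 ≤ c * K * c := by positivity
          linarith

end Split

/-! ### Spectra of the two summands -/

section Spectrum

variable {ι : Type*} [Fintype ι] [DecidableEq ι]

theorem Matrix.smul_mul_smul_inv_exp (M : Matrix ι ι ℝ) {N : Matrix ι ι ℝ} (hN : IsUnit N)
    (c t s : ℝ) :
    (Real.exp (-c * t) • M) * (Real.exp (-c * s) • N)⁻¹ =
      Real.exp (-c * (t - s)) • (M * N⁻¹) := by
  have h : (Real.exp (-c * s) • N)⁻¹ = Real.exp (c * s) • N⁻¹ := by
    refine Matrix.inv_eq_left_inv ?_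
    rw [Matrix.smul_mul, Matrix.mul_smul, Matrix.inv_mul_of_isUnit hN, smul_smul, ← Real.exp_add]
    simp
  rw [h, Matrix.smul_mul, Matrix.mul_smul, smul_smul, ← Real.exp_add]
  congr 2
  ring

/-- If the solutions of `y' = B(t) y` decay uniformly forward in time, then so do those of every
system shifted by `c ≥ 0`: it has an exponential dichotomy with projection `1`. -/
theorem IsFundamentalMatrix.hasExpDichotomy_of_stable {B Y : ℝ → Matrix ι ι ℝ}
    (hY : IsFundamentalMatrix B Y) {K α : ℝ} (hK : 0 < K) (hα : 0 < α)
    (h : ∀ t s, s ≤ t → ‖Y t * (Y s)⁻¹‖ ≤ K * Real.exp (-α * (t - s))) {c : ℝ} (hc : 0 ≤ c) :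
    HasExpDichotomy (fun t => B t - c • (1 : Matrix ι ι ℝ)) := by
  refine ⟨_, hY.sub_smul_one c, 1, K, α, Matrix.mul_one _, hK, hα, fun t s hts => ?_,
    fun t s hts => ?_⟩
  · rw [Matrix.mul_one, Matrix.smul_mul_smul_inv_exp _ (hY.2 s), norm_smul,
      Real.norm_eq_abs, Real.abs_exp]
    have : Real.exp (-c * (t - s)) ≤ 1 := Real.exp_le_one_iff.2 (by nlinarith)
    exact (mul_le_of_le_one_left (norm_nonneg _) this).trans (h t s hts)
  · rw [sub_self, Matrix.mul_zero, Matrix.zero_mul, norm_zero]; positivity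

/-- The time reversal of `IsFundamentalMatrix.hasExpDichotomy_of_stable`, with projection `0`. -/
theorem IsFundamentalMatrix.hasExpDichotomy_of_unstable {B Y : ℝ → Matrix ι ι ℝ}
    (hY : IsFundamentalMatrix B Y) {K α : ℝ} (hK : 0 < K) (hα : 0 < α)
    (h : ∀ t s, t ≤ s → ‖Y t * (Y s)⁻¹‖ ≤ K * Real.exp (-α * (s - t))) {c : ℝ} (hc : c ≤ 0) :
    HasExpDichotomy (fun t => B t - c • (1 : Matrix ι ι ℝ)) := by
  refine ⟨_, hY.sub_smul_one c, 0, K, α, Matrix.mul_zero _, hK, hα, fun t s hts => ?_,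
    fun t s hts => ?_⟩
  · rw [Matrix.mul_zero, Matrix.zero_mul, norm_zero]; positivity
  · rw [sub_zero, Matrix.mul_one, Matrix.smul_mul_smul_inv_exp _ (hY.2 s), norm_smul,
      Real.norm_eq_abs, Real.abs_exp]
    have : Real.exp (-c * (t - s)) ≤ 1 := Real.exp_le_one_iff.2 (by nlinarith)
    exact (mul_le_of_le_one_left (norm_nonneg _) this).trans (h t s hts)

/-- A point `γ` outside the spectrum splits the system, up to kinematic similarity, into a part with
the spectrum below `γ` and a part with the spectrum above `γ`. -/
theorem exists_spectral_split {A : ℝ → Matrix ι ι ℝ} (hA : Continuous A) {γ : ℝ}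
    (hγ : γ ∉ expDichotomySpectrum A) :
    ∃ (p q : ℕ) (B : ℝ → Matrix (Fin p) (Fin p) ℝ) (C : ℝ → Matrix (Fin q) (Fin q) ℝ),
      Continuous B ∧ Continuous C ∧
      KinematicallySimilar A (fun t => Matrix.fromBlocks (B t) 0 0 (C t)) ∧
      expDichotomySpectrum B = expDichotomySpectrum A ∩ Set.Iio γ ∧
      expDichotomySpectrum C = expDichotomySpectrum A ∩ Set.Ioi γ := by
  have hγ' : HasExpDichotomy fun t => A t - γ • (1 : Matrix ι ι ℝ) := not_not.1 hγ
  obtain ⟨p, q, B, Y, C, Z, hB, hC, hY, hZ, hsim, K, α, hK, hα, h1, h2⟩ :=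
    HasExpDichotomy.exists_split (A := fun t => A t - γ • (1 : Matrix ι ι ℝ))
      (hA.sub continuous_const) hγ'
  -- the frame was found for the system shifted by `γ`; the shift is undone in both blocks
  have hsim' : KinematicallySimilar A (fun t => Matrix.fromBlocks
      (B t - (-γ) • (1 : Matrix (Fin p) (Fin p) ℝ)) 0 0
      (C t - (-γ) • (1 : Matrix (Fin q) (Fin q) ℝ))) := by
    have h := hsim.sub_smul_one (-γ)
    simpa only [Matrix.fromBlocks_sub_smul_one, sub_sub, ← add_smul, add_neg_cancel, zero_smul,
      sub_zero] using h
  have hspec := hsim'.spectrum_eq.trans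
    (expDichotomySpectrum_fromBlocks (hY.sub_smul_one (-γ)) (hZ.sub_smul_one (-γ)))
  have hlow : expDichotomySpectrum (fun t => B t - (-γ) • (1 : Matrix (Fin p) (Fin p) ℝ)) ⊆
      Set.Iio γ := fun c hc => by
    by_contra hcγ
    refine hc ?_
    simp only [sub_sub, ← add_smul]
    exact hY.hasExpDichotomy_of_stable hK hα h1 (by linarith [not_lt.1 (Set.mem_Iio.not.1 hcγ)])
  have hhigh : expDichotomySpectrum (fun t => C t - (-γ) • (1 : Matrix (Fin q) (Fin q) ℝ)) ⊆
      Set.Ioi γ := fun c hc => by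
    by_contra hcγ
    refine hc ?_
    simp only [sub_sub, ← add_smul]
    exact hZ.hasExpDichotomy_of_unstable hK hα h2 (by linarith [not_lt.1 (Set.mem_Ioi.not.1 hcγ)])
  have hdisj : Disjoint (Set.Iio γ) (Set.Ioi γ) :=
    Set.disjoint_left.2 fun x (h : x < γ) (h' : γ < x) => lt_asymm h h'
  refine ⟨p, q, fun t => B t - (-γ) • (1 : Matrix (Fin p) (Fin p) ℝ),
    fun t => C t - (-γ) • (1 : Matrix (Fin q) (Fin q) ℝ), hB.sub continuous_const,
    hC.sub continuous_const, hsim', ?_, ?_⟩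
  · rw [hspec, Set.union_inter_distrib_right, Set.inter_eq_left.2 hlow,
      (hdisj.symm.mono_left hhigh).inter_eq, Set.union_empty]
  · rw [hspec, Set.union_inter_distrib_right, Set.inter_eq_left.2 hhigh,
      (hdisj.mono_left hlow).inter_eq, Set.empty_union]

end Spectrum

/-! ### Splitting off the spectral intervals one at a time -/

/-- The index set of a block decomposition with `k + 1` blocks, with the first block set apart. -/
def sigmaFinSuccEquiv {k : ℕ} (β : Fin (k + 1) → Type*) :
    (Σ i, β i) ≃ β 0 ⊕ Σ i : Fin k, β i.succ where
  toFun x := Fin.cases (motive := fun i => β i → β 0 ⊕ Σ i : Fin k, β i.succ) Sum.inl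
    (fun i y => Sum.inr ⟨i, y⟩) x.1 x.2
  invFun := Sum.elim (fun y => ⟨0, y⟩) fun z => ⟨z.1.succ, z.2⟩
  left_inv := fun ⟨i, y⟩ => by
    cases i using Fin.cases <;> rfl
  right_inv := fun x => by
    rcases x with y | ⟨i, y⟩ <;> rfl

theorem Matrix.blockDiagonal'_eq_submatrix_fromBlocks {k : ℕ} {m : Fin (k + 1) → ℕ}
    (B : ∀ i, Matrix (Fin (m i)) (Fin (m i)) ℝ) :
    blockDiagonal' B = (fromBlocks (B 0) 0 0 (blockDiagonal' fun i : Fin k => B i.succ)).submatrix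
      (sigmaFinSuccEquiv fun i => Fin (m i)) (sigmaFinSuccEquiv fun i => Fin (m i)) := by
  ext ⟨i, x⟩ ⟨j, y⟩
  cases i using Fin.cases with
  | zero =>
    cases j using Fin.cases with
    | zero => simp [sigmaFinSuccEquiv]
    | succ j =>
      rw [blockDiagonal'_apply_ne _ _ _ (Fin.succ_ne_zero j).symm]
      simp [sigmaFinSuccEquiv]
  | succ i =>
    cases j using Fin.cases with
    | zero =>
      rw [blockDiagonal'_apply_ne _ _ _ (Fin.succ_ne_zero i)]
      simp [sigmaFinSuccEquiv]
    | succ j =>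
      by_cases hij : i = j
      · subst hij; simp [sigmaFinSuccEquiv]
      · rw [blockDiagonal'_apply_ne _ _ _ fun h => hij (Fin.succ_injective _ h)]
        simp [sigmaFinSuccEquiv, blockDiagonal'_apply_ne _ _ _ hij]

/-- The conclusion of the theorem over the index type of pairs, by induction on the number of
intervals: a point of the first gap splits off the first interval. -/
theorem exists_spectral_blocks (k : ℕ) : ∀ (n : ℕ) (A : ℝ → Matrix (Fin n) (Fin n) ℝ)
    (a b : Fin (k + 1) → ℝ), Continuous A → (∀ i, a i ≤ b i) → (∀ i j, i < j → b i < a j) →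
    expDichotomySpectrum A = ⋃ i, Set.Icc (a i) (b i) →
    ∃ (m : Fin (k + 1) → ℕ) (B : ∀ i, ℝ → Matrix (Fin (m i)) (Fin (m i)) ℝ),
      (∀ i, Continuous (B i)) ∧ (∀ i, expDichotomySpectrum (B i) = Set.Icc (a i) (b i)) ∧
      KinematicallySimilar A (fun t => Matrix.blockDiagonal' fun i => B i t) := by
  induction k with
  | zero =>
    intro n A a b hA _ _ hspec
    refine ⟨fun _ => n, fun _ => A, fun _ => hA, fun i => ?_, ?_⟩
    · obtain rfl : i = 0 := Fin.eq_zero i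
      rw [hspec]
      exact iSup_unique (ι := Fin 1) (f := fun i => Set.Icc (a i) (b i))
    · have h := KinematicallySimilar.submatrix A (Equiv.uniqueSigma fun _ : Fin 1 => Fin n)
      convert h using 2 with t
      ext ⟨i, x⟩ ⟨j, y⟩
      obtain rfl : i = 0 := Fin.eq_zero i
      obtain rfl : j = 0 := Fin.eq_zero j
      rw [Matrix.blockDiagonal'_apply_eq]
      rfl
  | succ k ih =>
    intro n A a b hA hab hba hspec
    have h01 : b 0 < a 1 := hba 0 1 Fin.zero_lt_one
    obtain ⟨γ, hγ0, hγ1⟩ := exists_between h01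
    have hγ : ∀ i : Fin (k + 1), γ < a i.succ := fun i => by
      rcases (Fin.succ_le_succ_iff.2 (Fin.zero_le i)).eq_or_lt with h | h
      · rw [← h]; exact hγ1
      · exact hγ1.trans ((hab _).trans_lt (hba _ _ h))
    have hγA : γ ∉ expDichotomySpectrum A := by
      rw [hspec, Set.mem_iUnion]
      rintro ⟨i, h1, h2⟩
      cases i using Fin.cases with
      | zero => exact absurd h2 (not_le.2 hγ0)
      | succ i => exact absurd h1 (not_le.2 (hγ i))
    obtain ⟨p, q, B, C, hB, hC, hsim, hBspec, hCspec⟩ := exists_spectral_split hA hγA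
    have hBspec' : expDichotomySpectrum B = Set.Icc (a 0) (b 0) := by
      rw [hBspec, hspec]
      ext x
      simp only [Set.mem_inter_iff, Set.mem_iUnion, Set.mem_Iio]
      refine ⟨?_, fun h => ⟨⟨0, h⟩, h.2.trans_lt hγ0⟩⟩
      rintro ⟨⟨i, hi⟩, hx⟩
      cases i using Fin.cases with
      | zero => exact hi
      | succ i => exact absurd (hx.trans (hγ i)) (not_lt.2 hi.1)
    have hCspec' : expDichotomySpectrum C = ⋃ i : Fin (k + 1), Set.Icc (a i.succ) (b i.succ) := by
      rw [hCspec, hspec]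
      ext x
      simp only [Set.mem_inter_iff, Set.mem_iUnion, Set.mem_Ioi]
      refine ⟨?_, fun ⟨i, h⟩ => ⟨⟨i.succ, h⟩, (hγ i).trans_le h.1⟩⟩
      rintro ⟨⟨i, hi⟩, hx⟩
      cases i using Fin.cases with
      | zero => exact absurd (hγ0.trans hx) (not_lt.2 hi.2)
      | succ i => exact ⟨i, hi⟩
    obtain ⟨m, D, hD, hDspec, hDsim⟩ := ih q C (fun i => a i.succ) (fun i => b i.succ) hC
      (fun i => hab _) (fun i j hij => hba _ _ (Fin.succ_lt_succ_iff.2 hij)) hCspec'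
    let m' : Fin (k + 2) → ℕ := Fin.cons p m
    let D' : ∀ i, ℝ → Matrix (Fin (m' i)) (Fin (m' i)) ℝ := Fin.cons B D
    refine ⟨m', D', fun i => ?_, fun i => ?_, ?_⟩
    · cases i using Fin.cases with
      | zero => exact hB
      | succ i => exact hD i
    · cases i using Fin.cases with
      | zero => exact hBspec'
      | succ i => exact hDspec i
    · have h := (hsim.trans (hDsim.fromBlocks B)).trans
        (KinematicallySimilar.submatrix _ (sigmaFinSuccEquiv fun i => Fin (m' i)))
      have e := funext fun t => Matrix.blockDiagonal'_eq_submatrix_fromBlocks fun i => D' i t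
      rw [e]
      exact h

theorem KinematicallySimilar.generallyKinematicallySimilar {ι : Type*} [Fintype ι] [DecidableEq ι]
    {A B : ℝ → Matrix ι ι ℝ} (hA : Continuous A) (hB : Continuous B)
    (h : KinematicallySimilar A B) : GenerallyKinematicallySimilar A B := by
  obtain ⟨Q, R, h1, h2, h3, h4, C, hC⟩ := h
  have hQi : ∀ t, (Q t)⁻¹ = R t := fun t => Matrix.inv_eq_right_inv (h1 t)
  have hQd : Differentiable ℝ Q := fun t => (h3 t).differentiableAt
  have hRd : Differentiable ℝ R := fun t => (h4 t).differentiableAt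
  have hd : deriv Q = fun t => A t * Q t - Q t * B t := funext fun t => (h3 t).deriv
  refine ⟨hA, hB, Q, fun t => Matrix.isUnit_of_mul_eq_one (h1 t), hQd, hQd.continuous, ?_, ?_,
    ⟨C + C, fun t => ?_⟩, fun t => congrFun hd t⟩
  · simp only [hQi]; exact hRd.continuous
  · rw [hd]; exact (hA.mul hQd.continuous).sub (hQd.continuous.mul hB)
  · rw [hQi]; exact add_le_add (hC t).1 (hC t).2

theorem theorem5 (n ℓ : ℕ) (hℓ : 0 < ℓ) (A : ℝ → Matrix (Fin n) (Fin n) ℝ) (hA : Continuous A)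
    (a b : Fin ℓ → ℝ) (hab : ∀ i, a i ≤ b i) (hba : ∀ i j, i < j → b i < a j)
    (hspec : expDichotomySpectrum A = ⋃ i, Set.Icc (a i) (b i)) :
    ∃ (m : Fin ℓ → ℕ) (hm : ∑ i, m i = n)
      (B : ∀ i : Fin ℓ, ℝ → Matrix (Fin (m i)) (Fin (m i)) ℝ),
      (∀ i, Continuous (B i)) ∧
      (∀ i, expDichotomySpectrum (B i) = Set.Icc (a i) (b i)) ∧
      GenerallyKinematicallySimilar A (fun t => blockDiag m hm (fun i => B i t)) := by
  obtain ⟨k, rfl⟩ := Nat.exists_eq_succ_of_ne_zero hℓ.ne'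
  obtain ⟨m, B, hB, hBspec, hsim⟩ := exists_spectral_blocks k n A a b hA hab hba hspec
  -- the block sizes add up to `n` because the change of variables is invertible
  have hm : ∑ i, m i = n := by
    obtain ⟨Q, R, h1, h2, -⟩ := hsim
    have h := Matrix.square_of_invertible (Q 0) (R 0) (h1 0) (h2 0)
    simpa using h.symm
  refine ⟨m, hm, B, hB, hBspec, ?_⟩
  have hBc : Continuous fun t => Matrix.blockDiagonal' fun i => B i t :=
    (continuous_pi hB).matrix_blockDiagonal'
  exact (hsim.trans (KinematicallySimilar.submatrix _
    (finSigmaFinEquiv.trans (finCongr hm)).symm)).generallyKinematicallySimilar hA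
    (hBc.matrix_submatrix _ _)
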